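/- **Setting.** Let $T_1,T_2\in\mathbb R$, $p\ge 0$, $\mathcal H=L^2([T_1,T_2])^{p+1}$, and let $\mathcal S:\mathcal H\to\mathcal H$ be a bounded linear operator. Let $(\Omega,\mathcal F,\mathbb P)$ be a probability space and let $\mathcal V$ be the space of (jointly measurable) processes $A=(A_t(1),\dots,A_t(p+1))_{t\in[T_1,T_2]}$ with $\|A\|_{\mathcal V}^2=\mathbb E\int_{[T_1,T_2]}\sum_{i}A_t(i)^2\,dt<\infty$, processes being identified when they agree $\mathbb P\otimes dt$-almost everywhere; elements of $\mathcal V$ are called shifts. The noise $\epsilon$ is a random element of $\mathcal H$ on $\Omega$ with $\mathbb E\|\epsilon\|_{\mathcal H}^2<\infty$ and $\mathbb E[\epsilon]=0$. For every shift $A'\in\mathcal V$ there is an environment: a probability space with measure $\mathbb P_{A'}$ carrying a copy of $A'$ (with the same law in $\mathcal H$ as $A'$, and again denoted $A'$) and a noise $\epsilon_{A'}$ with the same law as $\epsilon$, independent of each other. In this environment one observes $(Y^{A'},X^{A'})=\mathcal S(A'+\epsilon_{A'})$, where $Y^{A'}$ is the first coordinate and $X^{A'}=(X^{A'}(1),\dots,X^{A'}(p))$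 the remaining ones. The observational environment $O$ is the environment of the shift $0$. For $\beta=(\beta(1),\dots,\beta(p))\in L^2([T_1,T_2]^2)^p$ the risk is $$R_{A'}(\beta)=\mathbb E_{A'}\left[\int_{[T_1,T_2]}\Big(Y^{A'}_t-\int_{[T_1,T_2]}\sum_{i=1}^p\beta(i)(t,\tau)\,X^{A'}_\tau(i)\,d\tau\Big)^2dt\right],$$ and $R_+(\beta)=R_A(\beta)+R_O(\beta)$, $R_\Delta(\beta)=R_A(\beta)-R_O(\beta)$. For $A'\in\mathcal V$ let $K_{A'}(s,t)$ be the $(p+1)\times(p+1)$ matrix with entries $\mathbb E[A'_s(i)A'_t(j)]$. For a set $\mathcal A\subseteq\mathcal V$, $A\in\mathcal V$ and $\gamma\ge0$ let $C^\gamma_{\mathcal A}(A)$ be the set of all $A'\in\mathcal A$ such that, for all $g=(g_1,\dots,g_{p+1})\in L^2([T_1,T_2])^{p+1}$, $$\int_{[T_1,T_2]^2}g(s)K_{A'}(s,t)g(t)^T\,ds\,dt\le\gamma\int_{[T_1,T_2]^2}g(s)K_{A}(s,t)g(t)^T\,ds\,dt .$$ **Theorem 3.7.** Let $\gamma\ge0$,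 $A\in\mathcal V$ and $\mathcal A\subseteq\mathcal V$, and suppose that $\sqrt\gamma A\in\mathcal A$ or, more generally, that $\sqrt\gamma A$ lies in the closure of $C^\gamma_{\mathcal A}(A)$ in $\mathcal V$. Then for every $\beta\in L^2([T_1,T_2]^2)^p$, $$\sup_{A'\in C^\gamma_{\mathcal A}(A)}R_{A'}(\beta)=\tfrac12R_+(\beta)+\big(\gamma-\tfrac12\big)R_\Delta(\beta)=\gamma R_A(\beta)+(1-\gamma)R_O(\beta)=R_{\sqrt\gamma A}(\beta).$$ Moreover, if $\sqrt\gamma A\in\mathcal A$, then $\sqrt\gamma A\in C^\gamma_{\mathcal A}(A)$, so the supremum is attained at $\sqrt\gamma A$. -/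

import Mathlib

open MeasureTheory ProbabilityTheory Set Topology

noncomputable section

namespace FunctionalSEM

/-- Lebesgue measure on the interval `[T₁, T₂]`. -/
abbrev timeMeasure (T₁ T₂ : ℝ) : Measure ℝ := volume.restrict (Icc T₁ T₂)

/-- The Hilbert space `L²([T₁, T₂])`. -/
abbrev L2Time (T₁ T₂ : ℝ) : Type := Lp ℝ 2 (timeMeasure T₁ T₂)

/-- The Hilbert space `L²([T₁, T₂])^{p+1}`, with the Hilbert sum norm. Coordinate `0` is the
coordinate of the target, coordinates `1, …, p` are those of the covariates. -/
abbrev StateSpace (p : ℕ) (T₁ T₂ : ℝ) : Type := PiLp 2 (fun _ : Fin (p + 1) => L2Time T₁ T₂)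

/-- Random elements of the state space are taken with respect to its Borel σ-algebra. -/
instance stateMeasurableSpace (p : ℕ) (T₁ T₂ : ℝ) : MeasurableSpace (StateSpace p T₁ T₂) :=
  borel _

instance stateBorelSpace (p : ℕ) (T₁ T₂ : ℝ) : BorelSpace (StateSpace p T₁ T₂) := ⟨rfl⟩

/-- The space `𝒱` of shifts: jointly measurable `ℝ^{p+1}`-valued processes
`A = (A_t(ω))`, `t ∈ [T₁, T₂]`, with `‖A‖² = E ∫ ‖A_t‖² dt < ∞`, up to `P ⊗ dt`-null sets.
The topology used on shifts is that of this norm. -/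
abbrev Shift {Ω : Type*} [MeasurableSpace Ω] (P : Measure Ω) (p : ℕ) (T₁ T₂ : ℝ) : Type _ :=
  Lp (EuclideanSpace ℝ (Fin (p + 1))) 2 (P.prod (timeMeasure T₁ T₂))

section Shifts

variable {Ω : Type*} [MeasurableSpace Ω] {P : Measure Ω} {p : ℕ} {T₁ T₂ : ℝ}

open Classical in
/-- The path `t ↦ A_t(ω)` of a shift as an element of `L²([T₁, T₂])^{p+1}`; by Fubini, almost
every path is square integrable (the exceptional `ω` get the zero path). -/
def path (A : Shift P p T₁ T₂) (ω : Ω) : StateSpace p T₁ T₂ :=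
  WithLp.toLp 2 fun i =>
    if h : MemLp (fun t : ℝ => A (ω, t) i) 2 (timeMeasure T₁ T₂) then h.toLp _ else 0

/-- The matrix-valued kernel `K_A(s, t)`, with entries `E[A_s(i) A_t(j)]`. -/
def crossKernel (A : Shift P p T₁ T₂) (s t : ℝ) : Matrix (Fin (p + 1)) (Fin (p + 1)) ℝ :=
  Matrix.of fun i j => ∫ ω, A (ω, s) i * A (ω, t) j ∂P

/-- The integral quadratic form `∫∫ g(s) K_A(s, t) g(t)ᵀ ds dt` over `[T₁, T₂]²`. -/
def kernelForm (A : Shift P p T₁ T₂) (g : Fin (p + 1) → L2Time T₁ T₂) : ℝ :=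
  ∫ z : ℝ × ℝ, (fun i => g i z.1) ⬝ᵥ ((crossKernel A z.1 z.2).mulVec fun j => g j z.2)
    ∂((timeMeasure T₁ T₂).prod (timeMeasure T₁ T₂))

/-- The regularization set `C^γ_𝒜(A)`: the shifts `A' ∈ 𝒜` with `K_{A'} ≤ γ K_A` in the sense of
the integral quadratic forms. -/
def regSet (𝒜 : Set (Shift P p T₁ T₂)) (γ : ℝ) (A : Shift P p T₁ T₂) : Set (Shift P p T₁ T₂) :=
  {A' | A' ∈ 𝒜 ∧ ∀ g : Fin (p + 1) → L2Time T₁ T₂, kernelForm A' g ≤ γ * kernelForm A g}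

end Shifts

/-- The environment of a shift `A`: a probability space carrying a copy `shift` of (the paths of)
`A` and a copy `noise` of the noise `ε`, independent of each other. The probability space may
differ from one environment to the other. -/
structure Environment {Ω : Type*} [MeasurableSpace Ω] {P : Measure Ω} {p : ℕ} {T₁ T₂ : ℝ}
    (ε : Ω → StateSpace p T₁ T₂) (A : Shift P p T₁ T₂) where
  /-- the sample space of the environment -/
  space : Type*
  /-- its events -/
  [measurableSpace : MeasurableSpace space]
  /-- its probability measure `P_A` -/
  prob : Measure space
  [isProbabilityMeasure : IsProbabilityMeasure prob]
  /-- the shift in this environment -/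
  shift : space → StateSpace p T₁ T₂
  /-- the noise `ε_A` in this environment -/
  noise : space → StateSpace p T₁ T₂
  identDistrib_shift : IdentDistrib shift (path A) prob P
  identDistrib_noise : IdentDistrib noise ε prob P
  indepFun : IndepFun shift noise prob

attribute [instance] Environment.measurableSpace Environment.isProbabilityMeasure

section Risk

variable {Ω : Type*} [MeasurableSpace Ω] {P : Measure Ω} {p : ℕ} {T₁ T₂ : ℝ}
  {ε : Ω → StateSpace p T₁ T₂} {A : Shift P p T₁ T₂}

/-- The observed pair `(Y, X) = S(A + ε_A)` in the environment of the shift `A`. -/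
def observed (S : StateSpace p T₁ T₂ →L[ℝ] StateSpace p T₁ T₂) (E : Environment ε A)
    (ω : E.space) : StateSpace p T₁ T₂ :=
  S (E.shift ω + E.noise ω)

/-- The target `Y`. -/
def target (S : StateSpace p T₁ T₂ →L[ℝ] StateSpace p T₁ T₂) (E : Environment ε A)
    (ω : E.space) : L2Time T₁ T₂ :=
  observed S E ω 0

/-- The covariates `X(1), …, X(p)`. -/
def covariate (S : StateSpace p T₁ T₂ →L[ℝ] StateSpace p T₁ T₂) (E : Environment ε A)
    (ω : E.space) (i : Fin p) : L2Time T₁ T₂ :=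
  observed S E ω i.succ

/-- The risk `E_A[∫ (Y_t - ∫ ∑ᵢ β(i)(t, τ) X_τ(i) dτ)² dt]` of the regression kernel
`β ∈ L²([T₁, T₂]²)^p` in an environment. -/
def risk (S : StateSpace p T₁ T₂ →L[ℝ] StateSpace p T₁ T₂) (E : Environment ε A)
    (β : Fin p → Lp ℝ 2 ((timeMeasure T₁ T₂).prod (timeMeasure T₁ T₂))) : ℝ :=
  ∫ ω, (∫ t in Icc T₁ T₂,
    (target S E ω t - ∫ τ in Icc T₁ T₂, ∑ i, β i (t, τ) * covariate S E ω i τ) ^ 2) ∂E.prob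

/-- `R_+(β) = R_A(β) + R_O(β)`, where the observational environment `O` is the one with the zero
shift. -/
def riskPlus (S : StateSpace p T₁ T₂ →L[ℝ] StateSpace p T₁ T₂)
    (env : ∀ A' : Shift P p T₁ T₂, Environment ε A') (A : Shift P p T₁ T₂)
    (β : Fin p → Lp ℝ 2 ((timeMeasure T₁ T₂).prod (timeMeasure T₁ T₂))) : ℝ :=
  risk S (env A) β + risk S (env 0) β

/-- `R_Δ(β) = R_A(β) - R_O(β)`. -/
def riskDelta (S : StateSpace p T₁ T₂ →L[ℝ] StateSpace p T₁ T₂)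
    (env : ∀ A' : Shift P p T₁ T₂, Environment ε A') (A : Shift P p T₁ T₂)
    (β : Fin p → Lp ℝ 2 ((timeMeasure T₁ T₂).prod (timeMeasure T₁ T₂))) : ℝ :=
  risk S (env A) β - risk S (env 0) β

end Risk

end FunctionalSEM

end

open FunctionalSEM

/-!
The residual `Y_t - ∫ ∑ᵢ β(i)(t, τ) X_τ(i) dτ` is `D (A + ε)` for a bounded linear operator
`D : L²([T₁, T₂])^{p+1} → L²([T₁, T₂])`, since regression against an `L²` kernel is a
Hilbert–Schmidt operator (`kernelOperator`, `residual`). The risk is therefore `E‖D (A + ε)‖²`, and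
because the noise is centred and independent of the shift it splits as `E‖D A‖² + E‖D ε‖²`
(`risk_eq_add`). The first summand is the squared norm of a bounded linear function of the shift in
`𝒱`, so it is continuous in the shift and is multiplied by `γ` when `A` is replaced by `√γ A`. This
gives the formula for the risk of `√γ A`, and it shows that every upper bound of the risk on the
regularization set holds on its closure too, hence at `√γ A`.

That no shift `A'` of the regularization set has a larger risk is a comparison of covariances. By
Fubini the quadratic form of `K_A` at `g` is `E⟨g, A⟩²` (`kernelForm_eq`). Expanding `‖D A‖²` in an
orthonormal basis `(eₖ)` of `L²([T₁, T₂])` gives `E‖D A‖² = ∑ₖ E⟨D* eₖ, A⟩²`, so the inequalities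
between quadratic forms at the functions `D* eₖ` add up to `E‖D A'‖² ≤ γ E‖D A‖²`
(`integral_norm_sq_map_le`).
-/

noncomputable section

namespace FunctionalSEM

/-! ### Second moments of random elements of a Hilbert space -/

section Hilbert

variable {Ω : Type*} [MeasurableSpace Ω] {P : Measure Ω} {H G : Type*}
  [NormedAddCommGroup H] [InnerProductSpace ℝ H] [CompleteSpace H]
  [NormedAddCommGroup G] [InnerProductSpace ℝ G]

theorem countable_of_orthonormal [TopologicalSpace.SeparableSpace G] {ι : Type*} {b : ι → G}
    (hb : Orthonormal ℝ b) : Countable ι := by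
  -- the balls of radius `1/2` around the `b i` are disjoint, since `‖b i - b j‖ = √2`
  refine Pairwise.countable_of_isOpen_disjoint (s := fun i => Metric.ball (b i) (1 / 2)) ?_
    (fun i => Metric.isOpen_ball) fun i => ⟨b i, Metric.mem_ball_self (by norm_num)⟩
  intro i j hij
  refine Metric.ball_disjoint_ball ?_
  have h : dist (b i) (b j) ^ 2 = 2 := by
    rw [dist_eq_norm, norm_sub_sq_real, hb.norm_eq_one, hb.norm_eq_one, hb.inner_eq_zero hij]
    norm_num
  nlinarith [dist_nonneg (x := b i) (y := b j)]

/-- Parseval's identity, integrated. -/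
theorem hasSum_integral_sq_inner {ι : Type*} [Countable ι] (b : HilbertBasis ι ℝ G)
    {F : Ω → G} (hF : MemLp F 2 P) :
    HasSum (fun i => ∫ ω, (inner ℝ (b i) (F ω)) ^ 2 ∂P) (∫ ω, ‖F ω‖ ^ 2 ∂P) := by
  have h (ω : Ω) : HasSum (fun i => (inner ℝ (b i) (F ω)) ^ 2) (‖F ω‖ ^ 2) := by
    have := b.hasSum_inner_mul_inner (F ω) (F ω)
    rw [real_inner_self_eq_norm_sq] at this
    refine this.congr_fun fun i => ?_
    rw [real_inner_comm, sq]
  refine hasSum_integral_of_dominated_convergence (fun i ω => (inner ℝ (b i) (F ω)) ^ 2)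
    (fun i => ?_) (fun i => .of_forall fun ω => ?_) (.of_forall fun ω => (h ω).summable) ?_
    (.of_forall h)
  · exact (aestronglyMeasurable_const.inner hF.1).pow 2
  · simp
  · simp_rw [(h _).tsum_eq]
    exact hF.integrable_norm_pow two_ne_zero

/-- A comparison `E⟨g, F'⟩² ≤ γ E⟨g, F⟩²` of second moments in all directions `g` is inherited by
the total second moments of the images under a bounded operator `D`: apply it to `g = D* e` for
`e` in an orthonormal basis and sum. -/
theorem integral_norm_sq_map_le [CompleteSpace G] [TopologicalSpace.SeparableSpace G] (D : H →L[ℝ] G)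
    {F F' : Ω → H} (hF : MemLp F 2 P) (hF' : MemLp F' 2 P) {γ : ℝ}
    (h : ∀ g : H, ∫ ω, (inner ℝ g (F' ω)) ^ 2 ∂P ≤ γ * ∫ ω, (inner ℝ g (F ω)) ^ 2 ∂P) :
    ∫ ω, ‖D (F' ω)‖ ^ 2 ∂P ≤ γ * ∫ ω, ‖D (F ω)‖ ^ 2 ∂P := by
  obtain ⟨w, b, -⟩ := exists_hilbertBasis ℝ G
  have := countable_of_orthonormal b.orthonormal
  refine hasSum_le (fun i => ?_) (hasSum_integral_sq_inner b (D.comp_memLp' hF'))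
    ((hasSum_integral_sq_inner b (D.comp_memLp' hF)).mul_left γ)
  simpa only [Function.comp_apply, ContinuousLinearMap.adjoint_inner_left] using h (D.adjoint (b i))

/-- The cross term vanishes by independence, since `V` is centred. -/
theorem integral_norm_sq_map_add [CompleteSpace G] [IsProbabilityMeasure P] [MeasurableSpace H] [BorelSpace H]
    (D : H →L[ℝ] G) {U V : Ω → H} (hU : MemLp U 2 P) (hV : MemLp V 2 P)
    (hUV : IndepFun U V P) (hV0 : ∫ ω, V ω ∂P = 0) :
    ∫ ω, ‖D (U ω + V ω)‖ ^ 2 ∂P = ∫ ω, ‖D (U ω)‖ ^ 2 ∂P + ∫ ω, ‖D (V ω)‖ ^ 2 ∂P := by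
  have hDU := D.comp_memLp' hU
  have hDV := D.comp_memLp' hV
  have hU1 := hU.integrable one_le_two
  have hV1 := hV.integrable one_le_two
  let B := (innerSL ℝ : G →L[ℝ] G →L[ℝ] ℝ).bilinearComp D D
  have hi : Integrable (fun ω => inner ℝ (D (U ω)) (D (V ω))) P :=
    hUV.integrable_bilin hU1 hV1 B
  have hzero : ∫ ω, inner ℝ (D (U ω)) (D (V ω)) ∂P = 0 := by
    simpa [B, hV0] using hUV.integral_bilin hU1 hV1 B
  have h1 := hDU.integrable_norm_pow two_ne_zero
  have h2 := hDV.integrable_norm_pow two_ne_zero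
  simp only [Function.comp_apply] at h1 h2
  simp_rw [map_add, norm_add_sq_real]
  rw [integral_add (by exact h1.add (hi.const_mul 2)) h2, integral_add h1 (hi.const_mul 2),
    integral_const_mul, hzero]
  simp

theorem norm_sq_eq_integral {α : Type*} [MeasurableSpace α] {μ : Measure α} (f : Lp G 2 μ) :
    ‖f‖ ^ 2 = ∫ a, ‖f a‖ ^ 2 ∂μ := by
  rw [← real_inner_self_eq_norm_sq, L2.inner_def]
  simp_rw [real_inner_self_eq_norm_sq]

end Hilbert

/-! ### Hilbert–Schmidt operators -/

section Kernel

variable {α : Type*} [MeasurableSpace α] {μ : Measure α}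

/-- The Cauchy–Schwarz inequality. -/
theorem sq_integral_mul_le {f : α → ℝ} (hf : MemLp f 2 μ) (g : Lp ℝ 2 μ) :
    (∫ a, f a * g a ∂μ) ^ 2 ≤ (∫ a, f a ^ 2 ∂μ) * ‖g‖ ^ 2 := by
  have h := real_inner_mul_inner_self_le (hf.toLp f) g
  rw [real_inner_self_eq_norm_sq, real_inner_self_eq_norm_sq, norm_sq_eq_integral (hf.toLp f),
    L2.inner_def] at h
  have h1 : ∫ a, inner ℝ (hf.toLp f a) (g a) ∂μ = ∫ a, f a * g a ∂μ := by
    refine integral_congr_ae ?_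
    filter_upwards [hf.coeFn_toLp] with a ha
    simp [ha, mul_comm]
  have h2 : ∫ a, ‖hf.toLp f a‖ ^ 2 ∂μ = ∫ a, f a ^ 2 ∂μ := by
    refine integral_congr_ae ?_
    filter_upwards [hf.coeFn_toLp] with a ha
    simp [ha]
  rwa [h1, h2, ← sq] at h

variable [SFinite μ] (b : Lp ℝ 2 (μ.prod μ))

theorem ae_memLp_section : ∀ᵐ t ∂μ, MemLp (fun τ => b (t, τ)) 2 μ := by
  filter_upwards [(Lp.aestronglyMeasurable b).prodMk_left, (Lp.memLp b).integrable_sq.prod_right_ae]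
    with t h1 h2
  exact (memLp_two_iff_integrable_sq h1).2 h2

theorem ae_sq_integral_section_le (f : Lp ℝ 2 μ) :
    ∀ᵐ t ∂μ, (∫ τ, b (t, τ) * f τ ∂μ) ^ 2 ≤ (∫ τ, b (t, τ) ^ 2 ∂μ) * ‖f‖ ^ 2 := by
  filter_upwards [ae_memLp_section b] with t ht using sq_integral_mul_le ht f

theorem memLp_integral_section (f : Lp ℝ 2 μ) :
    MemLp (fun t => ∫ τ, b (t, τ) * f τ ∂μ) 2 μ := by
  have hm : AEStronglyMeasurable (fun t => ∫ τ, b (t, τ) * f τ ∂μ) μ :=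
    ((Lp.aestronglyMeasurable b).mul (Lp.aestronglyMeasurable f).comp_snd).integral_prod_right'
  refine (memLp_two_iff_integrable_sq hm).2 ?_
  refine ((Lp.memLp b).integrable_sq.integral_prod_left.mul_const (‖f‖ ^ 2)).mono' (hm.pow 2) ?_
  filter_upwards [ae_sq_integral_section_le b f] with t ht
  simpa using ht

/-- The Hilbert–Schmidt operator `f ↦ (t ↦ ∫ b(t, τ) f(τ) dτ)` on `L²(μ)` with kernel
`b ∈ L²(μ ⊗ μ)`. -/
def kernelOperator : Lp ℝ 2 μ →L[ℝ] Lp ℝ 2 μ :=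
  LinearMap.mkContinuous
    { toFun := fun f => (memLp_integral_section b f).toLp _
      map_add' := fun f g => by
        rw [← MemLp.toLp_add]
        refine MemLp.toLp_congr _ _ ?_
        filter_upwards [ae_memLp_section b] with t ht
        rw [Pi.add_apply, ← integral_add (by exact ht.integrable_mul (Lp.memLp f))
          (by exact ht.integrable_mul (Lp.memLp g))]
        refine integral_congr_ae ?_
        filter_upwards [Lp.coeFn_add f g] with τ hτ
        rw [hτ, Pi.add_apply, mul_add]
      map_smul' := fun c f => by
        rw [RingHom.id_apply, ← MemLp.toLp_const_smul]
        refine MemLp.toLp_congr _ _ (.of_forall fun t => ?_)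
        rw [Pi.smul_apply, smul_eq_mul, ← integral_const_mul]
        refine integral_congr_ae ?_
        filter_upwards [Lp.coeFn_smul c f] with τ hτ
        simp [hτ, mul_left_comm] }
    ‖b‖ fun f => by
      refine (sq_le_sq₀ (norm_nonneg _) (by positivity)).1 ?_
      rw [mul_pow, norm_sq_eq_integral, norm_sq_eq_integral b,
        integral_prod _ ((Lp.memLp b).integrable_norm_pow two_ne_zero), ← integral_mul_const]
      simp only [Real.norm_eq_abs, sq_abs]
      refine integral_mono_ae (Lp.memLp _).integrable_sq
        ((Lp.memLp b).integrable_sq.integral_prod_left.mul_const (‖f‖ ^ 2)) ?_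
      filter_upwards [ae_sq_integral_section_le b f, (memLp_integral_section b f).coeFn_toLp]
        with t ht ht'
      simpa [ht'] using ht

theorem coeFn_kernelOperator (f : Lp ℝ 2 μ) :
    kernelOperator b f =ᵐ[μ] fun t => ∫ τ, b (t, τ) * f τ ∂μ :=
  (memLp_integral_section b f).coeFn_toLp

end Kernel

/-! ### Shifts as random elements of the state space -/

section Path

variable {Ω : Type*} [MeasurableSpace Ω] {P : Measure Ω} {p : ℕ} {T₁ T₂ : ℝ}

instance secondCountable_l2Time : SecondCountableTopology (L2Time T₁ T₂) :=
  have : Fact ((2 : ENNReal) ≠ ⊤) := ⟨by simp⟩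
  inferInstance

theorem memLp_coord (A : Shift P p T₁ T₂) (i : Fin (p + 1)) :
    MemLp (fun z => A z i) 2 (P.prod (timeMeasure T₁ T₂)) :=
  (EuclideanSpace.proj i : EuclideanSpace ℝ (Fin (p + 1)) →L[ℝ] ℝ).comp_memLp' (Lp.memLp A)

variable [SFinite P]

theorem ae_memLp_coord (A : Shift P p T₁ T₂) :
    ∀ᵐ ω ∂P, ∀ i, MemLp (fun t => A (ω, t) i) 2 (timeMeasure T₁ T₂) := by
  refine ae_all_iff.2 fun i => ?_
  filter_upwards [(memLp_coord A i).1.prodMk_left, (memLp_coord A i).integrable_sq.prod_right_ae]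
    with ω h1 h2
  exact (memLp_two_iff_integrable_sq h1).2 h2

theorem coeFn_path (A : Shift P p T₁ T₂) :
    ∀ᵐ ω ∂P, ∀ i, path A ω i =ᵐ[timeMeasure T₁ T₂] fun t => A (ω, t) i := by
  filter_upwards [ae_memLp_coord A] with ω h i
  simpa [path, h i] using (h i).coeFn_toLp

theorem path_ext {x y : StateSpace p T₁ T₂}
    (h : ∀ i, x i =ᵐ[timeMeasure T₁ T₂] y i) : x = y := by
  ext1 i
  exact Lp.ext (h i)

theorem path_add (A B : Shift P p T₁ T₂) : path (A + B) =ᵐ[P] fun ω => path A ω + path B ω := by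
  filter_upwards [coeFn_path A, coeFn_path B, coeFn_path (A + B),
    Measure.ae_ae_of_ae_prod (Lp.coeFn_add A B)] with ω hA hB hAB h
  refine path_ext fun i => ?_
  rw [PiLp.add_apply]
  filter_upwards [hA i, hB i, hAB i, h, Lp.coeFn_add (path A ω i) (path B ω i)]
    with t h1 h2 h3 h4 h5
  rw [h3, h5, h4]
  simp [h1, h2]

theorem path_smul (c : ℝ) (A : Shift P p T₁ T₂) : path (c • A) =ᵐ[P] fun ω => c • path A ω := by
  filter_upwards [coeFn_path A, coeFn_path (c • A),
    Measure.ae_ae_of_ae_prod (Lp.coeFn_smul c A)] with ω hA hB h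
  refine path_ext fun i => ?_
  rw [PiLp.smul_apply]
  filter_upwards [hA i, hB i, h, Lp.coeFn_smul c (path A ω i)] with t h1 h2 h3 h4
  rw [h2, h4, h3]
  simp [h1]

theorem norm_sq_path (A : Shift P p T₁ T₂) :
    ∀ᵐ ω ∂P, ‖path A ω‖ ^ 2 = ∫ t, ‖A (ω, t)‖ ^ 2 ∂timeMeasure T₁ T₂ := by
  filter_upwards [coeFn_path A, ae_memLp_coord A] with ω h h'
  simp_rw [PiLp.norm_sq_eq_of_L2, norm_sq_eq_integral, Real.norm_eq_abs, sq_abs]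
  rw [integral_finsetSum _ fun i _ => (h' i).integrable_sq]
  refine Finset.sum_congr rfl fun i _ => integral_congr_ae ?_
  filter_upwards [h i] with t ht
  rw [ht]

theorem memLp_path (A : Shift P p T₁ T₂) (hA : AEStronglyMeasurable (path A) P) :
    MemLp (path A) 2 P := by
  refine (memLp_two_iff_integrable_sq_norm hA).2 ?_
  exact ((Lp.memLp A).integrable_norm_pow two_ne_zero).integral_prod_left.congr
    ((norm_sq_path A).mono fun ω h => h.symm)

/-- The identification of shifts with square integrable random elements of the state space, as an
isometry. Measurability of the paths as a map into the state space is taken as a hypothesis, since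
it is part of the existence of the environments. -/
def pathIsometry (h : ∀ A : Shift P p T₁ T₂, AEStronglyMeasurable (path A) P) :
    Shift P p T₁ T₂ →ₗᵢ[ℝ] Lp (StateSpace p T₁ T₂) 2 P where
  toFun A := (memLp_path A (h A)).toLp _
  map_add' A B := by
    rw [← MemLp.toLp_add]
    exact MemLp.toLp_congr _ _ (path_add A B)
  map_smul' c A := by
    rw [RingHom.id_apply, ← MemLp.toLp_const_smul]
    exact MemLp.toLp_congr _ _ (path_smul c A)
  norm_map' A := by
    refine (sq_eq_sq₀ (norm_nonneg _) (norm_nonneg _)).1 ?_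
    rw [norm_sq_eq_integral, norm_sq_eq_integral A,
      integral_prod _ ((Lp.memLp A).integrable_norm_pow two_ne_zero)]
    refine integral_congr_ae ?_
    filter_upwards [norm_sq_path A, (memLp_path A (h A)).coeFn_toLp] with ω h1 h2
    rw [← h1]
    exact congrArg (fun x => ‖x‖ ^ 2) h2

theorem coeFn_pathIsometry (h : ∀ A : Shift P p T₁ T₂, AEStronglyMeasurable (path A) P)
    (A : Shift P p T₁ T₂) : pathIsometry h A =ᵐ[P] path A :=
  (memLp_path A (h A)).coeFn_toLp

theorem inner_path (A : Shift P p T₁ T₂) (g : Fin (p + 1) → L2Time T₁ T₂) :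
    ∀ᵐ ω ∂P, inner ℝ (WithLp.toLp 2 g) (path A ω) =
      ∑ i, ∫ t, g i t * A (ω, t) i ∂timeMeasure T₁ T₂ := by
  filter_upwards [coeFn_path A] with ω h
  rw [PiLp.inner_apply]
  refine Finset.sum_congr rfl fun i _ => ?_
  rw [L2.inner_def]
  refine integral_congr_ae ?_
  filter_upwards [h i] with t ht
  simp [ht, mul_comm]

theorem integrable_kernel_term (A : Shift P p T₁ T₂) (g : Fin (p + 1) → L2Time T₁ T₂)
    (i j : Fin (p + 1)) :
    Integrable (fun x : Ω × ℝ × ℝ => (g i x.2.1 * A (x.1, x.2.1) i) * (g j x.2.2 * A (x.1, x.2.2) j))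
      (P.prod ((timeMeasure T₁ T₂).prod (timeMeasure T₁ T₂))) := by
  -- group the factors as `A_s(i) g_j(t)` and `A_t(j) g_i(s)`, each square integrable in `(ω, s, t)`
  have key (i j : Fin (p + 1)) : MemLp (fun x : Ω × ℝ × ℝ => A (x.1, x.2.1) i * g j x.2.2) 2
      (P.prod ((timeMeasure T₁ T₂).prod (timeMeasure T₁ T₂))) := by
    have h : MemLp (fun z : (Ω × ℝ) × ℝ => A z.1 i * g j z.2) 2
        ((P.prod (timeMeasure T₁ T₂)).prod (timeMeasure T₁ T₂)) := by
      refine (memLp_two_iff_integrable_sq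
        ((memLp_coord A i).1.comp_fst.mul (Lp.memLp (g j)).1.comp_snd)).2 ?_
      simp_rw [Pi.mul_apply, mul_pow]
      exact (memLp_coord A i).integrable_sq.mul_prod (Lp.memLp (g j)).integrable_sq
    exact h.comp_measurePreserving ((measurePreserving_prodAssoc P _ _).symm)
  have hswap := (key j i).comp_measurePreserving
    ((MeasurePreserving.id P).prod (Measure.measurePreserving_swap
      (μ := timeMeasure T₁ T₂) (ν := timeMeasure T₁ T₂)))
  refine ((key i j).integrable_mul hswap).congr (.of_forall fun x => ?_)
  change A (x.1, x.2.1) i * g j x.2.2 * (A (x.1, x.2.2) j * g i x.2.1) = _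
  ring

/-- By Fubini, the quadratic form of the kernel `K_A` is the second moment of the path of `A` in
the direction `g`. -/
theorem kernelForm_eq (A : Shift P p T₁ T₂) (g : Fin (p + 1) → L2Time T₁ T₂) :
    kernelForm A g = ∫ ω, (inner ℝ (WithLp.toLp 2 g) (path A ω)) ^ 2 ∂P := by
  have h1 (z : ℝ × ℝ) :
      (fun i => g i z.1) ⬝ᵥ ((crossKernel A z.1 z.2).mulVec fun j => g j z.2) =
      ∑ i, ∑ j, ∫ ω, (g i z.1 * A (ω, z.1) i) * (g j z.2 * A (ω, z.2) j) ∂P := by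
    simp only [dotProduct, Matrix.mulVec, crossKernel, Matrix.of_apply, Finset.mul_sum]
    refine Finset.sum_congr rfl fun i _ => Finset.sum_congr rfl fun j _ => ?_
    rw [← integral_mul_const, ← integral_const_mul]
    congr 1 with ω
    ring
  have hint := integrable_kernel_term A g
  have h2 : ∀ᵐ ω ∂P, (inner ℝ (WithLp.toLp 2 g) (path A ω)) ^ 2 =
      ∑ i, ∑ j, ∫ z : ℝ × ℝ, (g i z.1 * A (ω, z.1) i) * (g j z.2 * A (ω, z.2) j)
        ∂((timeMeasure T₁ T₂).prod (timeMeasure T₁ T₂)) := by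
    filter_upwards [inner_path A g] with ω h
    rw [h, sq, Finset.sum_mul_sum]
    refine Finset.sum_congr rfl fun i _ => Finset.sum_congr rfl fun j _ => ?_
    exact (integral_prod_mul (fun t => g i t * A (ω, t) i) fun t => g j t * A (ω, t) j).symm
  rw [integral_congr_ae h2, kernelForm]
  rw [integral_congr_ae (.of_forall h1),
    integral_finsetSum _ fun i _ => integrable_finsetSum _ fun j _ =>
      (hint i j).integral_prod_right,
    integral_finsetSum _ fun i _ => integrable_finsetSum _ fun j _ =>
      (hint i j).integral_prod_left]
  refine Finset.sum_congr rfl fun i _ => ?_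
  rw [integral_finsetSum _ fun j _ => (hint i j).integral_prod_right,
    integral_finsetSum _ fun j _ => (hint i j).integral_prod_left]
  refine Finset.sum_congr rfl fun j _ => ?_
  exact (integral_integral_swap (hint i j)).symm

theorem kernelForm_smul (c : ℝ) (A : Shift P p T₁ T₂) (g : Fin (p + 1) → L2Time T₁ T₂) :
    kernelForm (c • A) g = c ^ 2 * kernelForm A g := by
  rw [kernelForm_eq, kernelForm_eq, ← integral_const_mul]
  refine integral_congr_ae ?_
  filter_upwards [path_smul c A] with ω h
  rw [h, inner_smul_right, mul_pow]

end Path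

/-! ### The risk as a second moment -/

section Risk

variable {Ω : Type*} [MeasurableSpace Ω] {P : Measure Ω} {p : ℕ} {T₁ T₂ : ℝ}

/-- The regression residual `t ↦ Y_t - ∫ ∑ᵢ β(i)(t, τ) X_τ(i) dτ` of `(Y, X) = S h`, as a bounded
linear function of the input `h`. -/
def residual (S : StateSpace p T₁ T₂ →L[ℝ] StateSpace p T₁ T₂)
    (β : Fin p → Lp ℝ 2 ((timeMeasure T₁ T₂).prod (timeMeasure T₁ T₂))) :
    StateSpace p T₁ T₂ →L[ℝ] L2Time T₁ T₂ :=
  (PiLp.proj 2 (fun _ : Fin (p + 1) => L2Time T₁ T₂) 0 -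
    ∑ i, kernelOperator (β i) ∘L PiLp.proj 2 (fun _ : Fin (p + 1) => L2Time T₁ T₂) i.succ) ∘L S

theorem coeFn_residual (S : StateSpace p T₁ T₂ →L[ℝ] StateSpace p T₁ T₂)
    (β : Fin p → Lp ℝ 2 ((timeMeasure T₁ T₂).prod (timeMeasure T₁ T₂)))
    (h : StateSpace p T₁ T₂) :
    residual S β h =ᵐ[timeMeasure T₁ T₂] fun t =>
      S h 0 t - ∫ τ in Icc T₁ T₂, ∑ i, β i (t, τ) * S h i.succ τ := by
  have hsum : residual S β h = S h 0 - ∑ i, kernelOperator (β i) (S h i.succ) := by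
    simp [residual]
  rw [hsum]
  filter_upwards [Lp.coeFn_sub (S h 0) (∑ i, kernelOperator (β i) (S h i.succ)),
    Lp.coeFn_fun_finsetSum Finset.univ fun i => kernelOperator (β i) (S h i.succ),
    ae_all_iff.2 fun i => coeFn_kernelOperator (β i) (S h i.succ),
    ae_all_iff.2 fun i => ae_memLp_section (β i)] with t h1 h2 h3 h4
  rw [h1, Pi.sub_apply, h2, integral_finsetSum _ fun i _ => by exact (h4 i).integrable_mul (Lp.memLp (S h i.succ))]
  simp_rw [h3]

variable {ε : Ω → StateSpace p T₁ T₂} {A : Shift P p T₁ T₂}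

theorem risk_eq_integral_norm_sq (S : StateSpace p T₁ T₂ →L[ℝ] StateSpace p T₁ T₂)
    (E : Environment ε A)
    (β : Fin p → Lp ℝ 2 ((timeMeasure T₁ T₂).prod (timeMeasure T₁ T₂))) :
    risk S E β = ∫ ω, ‖residual S β (E.shift ω + E.noise ω)‖ ^ 2 ∂E.prob := by
  unfold risk
  congr 1 with ω
  rw [norm_sq_eq_integral]
  refine integral_congr_ae ?_
  filter_upwards [coeFn_residual S β (E.shift ω + E.noise ω)] with t ht
  rw [ht, Real.norm_eq_abs, sq_abs]
  rfl

/-- Implicit in the environment: equality in law presupposes that both variables are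
measurable. -/
theorem aestronglyMeasurable_path (E : Environment ε A) : AEStronglyMeasurable (path A) P :=
  E.identDistrib_shift.aemeasurable_snd.aestronglyMeasurable

/-- The risk splits into the contributions of the shift and of the noise. -/
theorem risk_eq_add [SFinite P] (hε : MemLp ε 2 P) (hε_mean : ∫ ω, ε ω ∂P = 0)
    (S : StateSpace p T₁ T₂ →L[ℝ] StateSpace p T₁ T₂) (E : Environment ε A)
    (β : Fin p → Lp ℝ 2 ((timeMeasure T₁ T₂).prod (timeMeasure T₁ T₂))) :
    risk S E β = ∫ ω, ‖residual S β (path A ω)‖ ^ 2 ∂P + ∫ ω, ‖residual S β (ε ω)‖ ^ 2 ∂P := by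
  have hmeas : Measurable fun x => ‖residual S β x‖ ^ 2 :=
    ((residual S β).continuous.norm.pow 2).measurable
  have hs := E.identDistrib_shift
  have hn := E.identDistrib_noise
  rw [risk_eq_integral_norm_sq, integral_norm_sq_map_add (residual S β)
    (hs.memLp_iff.2 (memLp_path A (aestronglyMeasurable_path E))) (hn.memLp_iff.2 hε) E.indepFun
    (hn.integral_eq.trans hε_mean)]
  exact congrArg₂ (· + ·) (hs.comp hmeas).integral_eq (hn.comp hmeas).integral_eq

/-- The contribution of the shift to the risk is the squared norm of a bounded linear function of
the shift. -/
theorem integral_norm_sq_residual_path [SFinite P]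
    (h : ∀ A : Shift P p T₁ T₂, AEStronglyMeasurable (path A) P)
    (S : StateSpace p T₁ T₂ →L[ℝ] StateSpace p T₁ T₂)
    (β : Fin p → Lp ℝ 2 ((timeMeasure T₁ T₂).prod (timeMeasure T₁ T₂)))
    (A : Shift P p T₁ T₂) :
    ∫ ω, ‖residual S β (path A ω)‖ ^ 2 ∂P =
      ‖(residual S β).compLpL 2 P (pathIsometry h A)‖ ^ 2 := by
  rw [norm_sq_eq_integral]
  refine integral_congr_ae ?_
  filter_upwards [coeFn_pathIsometry h A, (residual S β).coeFn_compLpL (p := 2) (pathIsometry h A)]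
    with ω h1 h2
  rw [h2, h1]

/-- On the regularization set, the contribution of the shift to the risk is at most `γ` times that
of `A`. -/
theorem integral_norm_sq_residual_path_le [SFinite P] {𝒜 : Set (Shift P p T₁ T₂)} {γ : ℝ}
    (h : ∀ A : Shift P p T₁ T₂, AEStronglyMeasurable (path A) P)
    (S : StateSpace p T₁ T₂ →L[ℝ] StateSpace p T₁ T₂)
    (β : Fin p → Lp ℝ 2 ((timeMeasure T₁ T₂).prod (timeMeasure T₁ T₂)))
    {A A' : Shift P p T₁ T₂} (hA' : A' ∈ regSet 𝒜 γ A) :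
    ∫ ω, ‖residual S β (path A' ω)‖ ^ 2 ∂P ≤ γ * ∫ ω, ‖residual S β (path A ω)‖ ^ 2 ∂P := by
  refine integral_norm_sq_map_le _ (memLp_path A (h A)) (memLp_path A' (h A')) fun g => ?_
  have := hA'.2 g.ofLp
  rwa [kernelForm_eq, kernelForm_eq] at this

end Risk

end FunctionalSEM

end

open FunctionalSEM
theorem theorem3p7 {Ω : Type*} [MeasurableSpace Ω] (P : Measure Ω) [IsProbabilityMeasure P]
    (p : ℕ) (T₁ T₂ : ℝ)
    (S : StateSpace p T₁ T₂ →L[ℝ] StateSpace p T₁ T₂)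
    (ε : Ω → StateSpace p T₁ T₂) (hε : MemLp ε 2 P) (hε_mean : ∫ ω, ε ω ∂P = 0)
    (env : ∀ A' : Shift P p T₁ T₂, Environment ε A')
    (𝒜 : Set (Shift P p T₁ T₂)) (A : Shift P p T₁ T₂) (γ : ℝ) (hγ : 0 ≤ γ)
    (hA : √γ • A ∈ 𝒜 ∨ √γ • A ∈ closure (regSet 𝒜 γ A))
    (β : Fin p → Lp ℝ 2 ((timeMeasure T₁ T₂).prod (timeMeasure T₁ T₂))) :
    -- the worst-case risk over the regularization set
    IsLUB ((fun A' => risk S (env A') β) '' regSet 𝒜 γ A)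
      (1 / 2 * riskPlus S env A β + (γ - 1 / 2) * riskDelta S env A β) ∧
    1 / 2 * riskPlus S env A β + (γ - 1 / 2) * riskDelta S env A β =
      γ * risk S (env A) β + (1 - γ) * risk S (env 0) β ∧
    -- it is the risk of `√γ A`, which is a maximizer as soon as it belongs to `𝒜`
    risk S (env (√γ • A)) β =
      1 / 2 * riskPlus S env A β + (γ - 1 / 2) * riskDelta S env A β ∧
    (√γ • A ∈ 𝒜 → √γ • A ∈ regSet 𝒜 γ A) := by
  have hpath (A' : Shift P p T₁ T₂) := aestronglyMeasurable_path (env A')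
  let L := (residual S β).compLpL 2 P ∘L (pathIsometry hpath).toContinuousLinearMap
  let c := ∫ ω, ‖residual S β (ε ω)‖ ^ 2 ∂P
  have hrisk (A' : Shift P p T₁ T₂) : risk S (env A') β = ‖L A'‖ ^ 2 + c := by
    rw [risk_eq_add hε hε_mean, integral_norm_sq_residual_path hpath]
    rfl
  have hform : 1 / 2 * riskPlus S env A β + (γ - 1 / 2) * riskDelta S env A β =
      γ * risk S (env A) β + (1 - γ) * risk S (env 0) β := by
    rw [riskPlus, riskDelta]
    ring
  have hsqrt : risk S (env (√γ • A)) β = γ * risk S (env A) β + (1 - γ) * risk S (env 0) β := by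
    rw [hrisk, hrisk, hrisk, map_smul, map_zero, norm_smul, mul_pow, Real.norm_eq_abs, sq_abs,
      Real.sq_sqrt hγ, norm_zero]
    ring
  have hmem (h : √γ • A ∈ 𝒜) : √γ • A ∈ regSet 𝒜 γ A :=
    ⟨h, fun g => by rw [kernelForm_smul, Real.sq_sqrt hγ]⟩
  refine ⟨?_, hform, hsqrt.trans hform.symm, hmem⟩
  rw [hform]
  constructor
  · rintro _ ⟨A', hA', rfl⟩
    have := integral_norm_sq_residual_path_le hpath S β hA'
    rw [integral_norm_sq_residual_path hpath, integral_norm_sq_residual_path hpath] at this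
    change ‖L A'‖ ^ 2 ≤ γ * ‖L A‖ ^ 2 at this
    simp only [hrisk, map_zero, norm_zero]
    linarith
  · intro b hb
    rw [← hsqrt]
    have hclosed : IsClosed {A' | risk S (env A') β ≤ b} := by
      simp_rw [hrisk]
      exact isClosed_le ((L.continuous.norm.pow 2).add continuous_const) continuous_const
    exact closure_minimal (fun A' hA' => hb ⟨A', hA', rfl⟩) hclosed
      (hA.elim (fun h => subset_closure (hmem h)) id)
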